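/- Let $X$ be a finite-dimensional Euclidean space with distance $d$, let $\mu$ be a Borel probability measure on $X$, and let $f\colon X\to X$ be a measurable map preserving $\mu$. For $x\in X$ and $r>0$ let $\tau_r(x)=\inf\{n\ge 1\colon d(f^n x,x)<r\}$ (with $\inf\emptyset=\infty$) and define $$\underline R(x)=\liminf_{r\to0^+}\frac{\log\tau_r(x)}{\log(1/r)},\quad \overline R(x)=\limsup_{r\to0^+}\frac{\log\tau_r(x)}{\log(1/r)},\quad \underline d_\mu(x)=\liminf_{r\to0^+}\frac{\log\mu(B(x,r))}{\log r},\quad \overline d_\mu(x)=\limsup_{r\to0^+}\frac{\log\mu(B(x,r))}{\log r}.$$ For a bounded Lipschitz function $\phi\colon X\to\mathbb R$ let $\|\phi\|=\sup|\phi|+\mathrm{Lip}(\phi)$, where $\mathrm{Lip}(\phi)$ is the least Lipschitz constant of $\phi$. Assume that the local decay of correlations is super-polynomial: there is a partition modulo $\mu$ of $X$ into open sets $V_i$ (that is, $\mu(V_i\cap V_j)=0$ for $i\ne j$ and $\mu(X\setminus\bigcup_i V_i)=0$) and for each $i$ a real sequence $(\theta^i_n)_{n}$ with $\lim_{n\to\infty}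 n^p\,\theta^i_n=0$ for every $p>0$, such that $$\left|\int \phi\circ f^n\,\psi\,d\mu-\int\phi\,d\mu\int\psi\,d\mu\right|\le\|\phi\|\,\|\psi\|\,\theta^i_n$$ for all $n$ and all bounded Lipschitz functions $\phi,\psi$ with $\operatorname{supp}\phi\subset V_i$ and $\operatorname{supp}\psi\subset V_i$ (closed supports). Then for $\mu$-almost every $x$ with $\underline R(x)>0$ one has $\underline R(x)=\underline d_\mu(x)$ and $\overline R(x)=\overline d_\mu(x)$. -/

import Mathlib

open MeasureTheory Filter Topology

namespace Recurrence

noncomputable section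

/-- The return time `τ_r(x) = inf {n ≥ 1 : d(f^n x, x) < r}`, with `inf ∅ = ∞`. -/
def returnTime {X : Type*} [PseudoMetricSpace X] (f : X → X) (r : ℝ) (x : X) : ℕ∞ :=
  sInf {k : ℕ∞ | ∃ n : ℕ, k = (n : ℕ∞) ∧ 1 ≤ n ∧ dist (f^[n] x) x < r}

/-- The lower recurrence rate `liminf_{r → 0+} log τ_r(x) / log (1/r)`, with `log ∞ = ∞`. -/
def lowerRecurrenceRate {X : Type*} [PseudoMetricSpace X] (f : X → X) (x : X) : EReal :=
  liminf (fun r : ℝ => ENNReal.log (returnTime f r x : ENNReal) / (Real.log (1 / r) : EReal))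
    (𝓝[>] (0 : ℝ))

/-- The upper recurrence rate `limsup_{r → 0+} log τ_r(x) / log (1/r)`, with `log ∞ = ∞`. -/
def upperRecurrenceRate {X : Type*} [PseudoMetricSpace X] (f : X → X) (x : X) : EReal :=
  limsup (fun r : ℝ => ENNReal.log (returnTime f r x : ENNReal) / (Real.log (1 / r) : EReal))
    (𝓝[>] (0 : ℝ))

/-- The lower pointwise dimension `liminf_{r → 0+} log μ(B(x,r)) / log r`, with `log 0 = -∞`. -/
def lowerPointwiseDim {X : Type*} [PseudoMetricSpace X] [MeasurableSpace X] (μ : Measure X)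
    (x : X) : EReal :=
  liminf (fun r : ℝ => ENNReal.log (μ (Metric.ball x r)) / (Real.log r : EReal)) (𝓝[>] (0 : ℝ))

/-- The upper pointwise dimension `limsup_{r → 0+} log μ(B(x,r)) / log r`, with `log 0 = -∞`. -/
def upperPointwiseDim {X : Type*} [PseudoMetricSpace X] [MeasurableSpace X] (μ : Measure X)
    (x : X) : EReal :=
  limsup (fun r : ℝ => ENNReal.log (μ (Metric.ball x r)) / (Real.log r : EReal)) (𝓝[>] (0 : ℝ))

/-- Bounded real Lipschitz functions, i.e. those whose Lipschitz norm is finite. -/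
def IsBoundedLipschitz {X : Type*} [PseudoMetricSpace X] (φ : X → ℝ) : Prop :=
  (∃ K : NNReal, LipschitzWith K φ) ∧ ∃ M : ℝ, ∀ x, |φ x| ≤ M

/-- The Lipschitz norm `sup |φ| + Lip(φ)` of a bounded Lipschitz function, where `Lip(φ)` is the
least Lipschitz constant. -/
def lipNorm {X : Type*} [PseudoMetricSpace X] (φ : X → ℝ) : ℝ :=
  (⨆ x, |φ x|) + ((sInf {K : NNReal | LipschitzWith K φ} : NNReal) : ℝ)

/-- A family of open sets which is a partition modulo `μ`: distinct members meet in null sets and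
the union has full measure. -/
def IsOpenPartitionMod {X : Type*} [TopologicalSpace X] [MeasurableSpace X] (μ : Measure X)
    (𝒱 : Set (Set X)) : Prop :=
  (∀ V ∈ 𝒱, IsOpen V) ∧ 𝒱.Pairwise (AEDisjoint μ) ∧ μ (⋃₀ 𝒱)ᶜ = 0

/-- A sequence tending to `0` faster than every negative power of `n`. -/
def IsSuperPolynomiallySmall (θ : ℕ → ℝ) : Prop :=
  ∀ p : ℝ, 0 < p → Tendsto (fun n : ℕ => (n : ℝ) ^ p * θ n) atTop (𝓝 0)

/-- The local decay of correlations of `(X, f, μ)` is super-polynomial. The supports are the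
closed supports, and the rate may depend on the member of the partition. -/
def HasLocalSuperPolynomialDecay {X : Type*} [PseudoMetricSpace X] [MeasurableSpace X]
    (f : X → X) (μ : Measure X) : Prop :=
  ∃ 𝒱 : Set (Set X), IsOpenPartitionMod μ 𝒱 ∧
    ∀ V ∈ 𝒱, ∃ θ : ℕ → ℝ, IsSuperPolynomiallySmall θ ∧
      ∀ φ ψ : X → ℝ, IsBoundedLipschitz φ → IsBoundedLipschitz ψ →
        tsupport φ ⊆ V → tsupport ψ ⊆ V → ∀ n : ℕ,
          |(∫ x, φ (f^[n] x) * ψ x ∂μ) - (∫ x, φ x ∂μ) * ∫ x, ψ x ∂μ|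
            ≤ lipNorm φ * lipNorm ψ * θ n

end

end Recurrence

/-! Both equalities follow from one estimate: for almost every x with positive lower recurrence
rate, and every ε > 0, the product τ_r(x) μ(B(x,r)) lies between r^ε and r^(-ε) for all small r.
Errors of the form q^n with q < 1 are therefore harmless at the scale r = 2⁻ⁿ, and being summable
they suit Borel–Cantelli.

Balls and dyadic cubes of comparable size are interchangeable up to such errors, although μ need not
be doubling: a cube much lighter than its neighbourhood contributes little mass, and neighbourhoods
overlap boundedly (`ae_eventually_pow_mul_measure_ball_le`).

The upper bound needs only invariance. By Kac's argument, points of a cube Q that stay away from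
themselves for N steps have mass at most 1/(N+1), so τ is rarely much larger than 1/μ(Q)
(`ae_eventually_pow_mul_measure_cube_mul_returnTime_le`).

The lower bound uses mixing. The points of a ball B that are back in B at time k have mass about
μ(B)², up to a correlation error. Summed over k well below 1/μ(B), the main terms are a small
fraction of μ(B). The error is negligible only when k is at least a power of 2ⁿ; the assumption of a
positive lower rate excludes the earlier times (`exists_pow_le_pow_of_lowerRecurrenceRate_pos`,
`ae_eventually_notMem_earlyReturns`). -/

namespace Recurrence

/-! ### Dyadic cubes and weak doubling almost everywhere. -/

section Cubes

variable {X : Type*} [NormedAddCommGroup X] [InnerProductSpace ℝ X] [FiniteDimensional ℝ X]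

/-- The index of the dyadic cube of side `2⁻ⁿ` containing `x`, in orthonormal coordinates. -/
noncomputable def cubeIdx (n : ℕ) (x : X) : Fin (Module.finrank ℝ X) → ℤ :=
  fun i => ⌊(2 : ℝ) ^ n * (stdOrthonormalBasis ℝ X).repr x i⌋

/-- The dyadic cube of side `2⁻ⁿ` with index `z`. -/
def cube (n : ℕ) (z : Fin (Module.finrank ℝ X) → ℤ) : Set X := cubeIdx n ⁻¹' {z}

theorem mem_cube {n : ℕ} {z : Fin (Module.finrank ℝ X) → ℤ} {x : X} :
    x ∈ cube n z ↔ cubeIdx n x = z := Iff.rfl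

theorem mem_cube_cubeIdx (n : ℕ) (x : X) : x ∈ cube n (cubeIdx n x) := rfl

theorem abs_repr_le_norm (v : X) (i : Fin (Module.finrank ℝ X)) :
    |(stdOrthonormalBasis ℝ X).repr v i| ≤ ‖v‖ := by
  rw [OrthonormalBasis.repr_apply_apply]
  refine (abs_real_inner_le_norm _ _).trans ?_
  simp

theorem norm_le_sum_abs_repr (v : X) :
    ‖v‖ ≤ ∑ i, |(stdOrthonormalBasis ℝ X).repr v i| := by
  conv_lhs => rw [← (stdOrthonormalBasis ℝ X).sum_repr v]
  refine (norm_sum_le _ _).trans (Finset.sum_le_sum fun i _ => ?_)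
  simp [norm_smul]

/-- The crude constant 2 ^ d, in place of √d, is a power of two, so that it can be absorbed by
shifting the scale `n`. -/
theorem dist_lt_of_cubeIdx_eq {n : ℕ} {x y : X} (h : cubeIdx n x = cubeIdx n y) :
    dist x y < 2 ^ Module.finrank ℝ X * (1 / 2 : ℝ) ^ n := by
  have key : ∀ i, |(stdOrthonormalBasis ℝ X).repr (x - y) i| ≤ (1 / 2 : ℝ) ^ n := by
    intro i
    have h1 := Int.abs_sub_lt_one_of_floor_eq_floor (congrFun h i)
    rw [← mul_sub, abs_mul, abs_of_pos (by positivity)] at h1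
    rw [map_sub, one_div, inv_pow, ← one_div, le_div_iff₀' (by positivity)]
    exact h1.le
  have h2 : dist x y ≤ Module.finrank ℝ X * (1 / 2 : ℝ) ^ n := by
    rw [dist_eq_norm]
    refine (norm_le_sum_abs_repr _).trans ((Finset.sum_le_sum fun i _ => key i).trans ?_)
    simp
  refine h2.trans_lt ?_
  gcongr
  exact_mod_cast Nat.lt_two_pow_self

theorem abs_cubeIdx_sub_le {n N : ℕ} {x y : X} (h : dist x y < N * (1 / 2 : ℝ) ^ n)
    (i : Fin (Module.finrank ℝ X)) : |cubeIdx n x i - cubeIdx n y i| ≤ N := by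
  have h1 := (abs_repr_le_norm (x - y) i).trans_lt (dist_eq_norm x y ▸ h)
  have h2 : |(2 : ℝ) ^ n * (stdOrthonormalBasis ℝ X).repr x i
      - (2 : ℝ) ^ n * (stdOrthonormalBasis ℝ X).repr y i| < N := by
    rw [← mul_sub, abs_mul, abs_of_pos (by positivity : (0 : ℝ) < 2 ^ n)]
    rw [map_sub, one_div, inv_pow, ← div_eq_mul_inv, lt_div_iff₀' (by positivity)] at h1
    exact h1
  rw [abs_lt] at h2
  unfold cubeIdx
  set u := (2 : ℝ) ^ n * (stdOrthonormalBasis ℝ X).repr x i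
  set v := (2 : ℝ) ^ n * (stdOrthonormalBasis ℝ X).repr y i
  have a1 := Int.floor_le u
  have a2 := Int.lt_floor_add_one u
  have a3 := Int.floor_le v
  have a4 := Int.lt_floor_add_one v
  have e1 : ((⌊u⌋ - ⌊v⌋ : ℤ) : ℝ) < ((N + 1 : ℤ) : ℝ) := by push_cast; linarith
  have e2 : ((-(N + 1) : ℤ) : ℝ) < ((⌊u⌋ - ⌊v⌋ : ℤ) : ℝ) := by push_cast; linarith
  rw [Int.cast_lt] at e1 e2
  rw [abs_le]
  omega

theorem cubeIdx_zero (n : ℕ) : cubeIdx n (0 : X) = 0 := by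
  ext i; simp [cubeIdx]

/-- The indices at distance at most `N` from zero. -/
noncomputable def idxBox (X : Type*) [NormedAddCommGroup X] [InnerProductSpace ℝ X] [FiniteDimensional ℝ X]
    (N : ℕ) : Finset (Fin (Module.finrank ℝ X) → ℤ) :=
  Fintype.piFinset fun _ => Finset.Icc (-(N : ℤ)) N

theorem mem_idxBox {N : ℕ} {w : Fin (Module.finrank ℝ X) → ℤ} :
    w ∈ idxBox X N ↔ ∀ i, |w i| ≤ N := by
  simp [idxBox, abs_le]

theorem card_idxBox (N : ℕ) : (idxBox X N).card = (2 * N + 1) ^ Module.finrank ℝ X := by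
  simp only [idxBox, Fintype.card_piFinset, Int.card_Icc, Finset.prod_const, Finset.card_univ,
    Fintype.card_fin]
  congr 1
  omega

theorem ball_subset_iUnion_cube (n N : ℕ) (y : X) :
    Metric.ball y (N * (1 / 2 : ℝ) ^ n) ⊆ ⋃ w ∈ idxBox X N, cube n (cubeIdx n y + w) := by
  intro x hx
  simp only [Set.mem_iUnion]
  refine ⟨cubeIdx n x - cubeIdx n y, mem_idxBox.2 fun i => abs_cubeIdx_sub_le hx i, ?_⟩
  simp [mem_cube]

theorem cube_subset_ball (n : ℕ) (y : X) :
    cube n (cubeIdx n y) ⊆ Metric.ball y (2 ^ Module.finrank ℝ X * (1 / 2 : ℝ) ^ n) :=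
  fun _ hx => dist_lt_of_cubeIdx_eq hx

theorem cubeIdx_mem_idxBox_of_norm_le {y : X} {m : ℕ} (h : ‖y‖ ≤ m) (n : ℕ) :
    cubeIdx n y ∈ idxBox X ((m + 1) * 2 ^ n) := by
  refine mem_idxBox.2 fun i => ?_
  have h1 : dist y 0 < ((m + 1) * 2 ^ n : ℕ) * (1 / 2 : ℝ) ^ n := by
    push_cast
    rw [mul_assoc, ← mul_pow, dist_zero_right]
    norm_num
    linarith
  simpa [cubeIdx_zero] using abs_cubeIdx_sub_le h1 i

variable [MeasurableSpace X]

theorem measure_le_tsum_inter_cube (μ : Measure X) (n : ℕ) (E : Set X) :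
    μ E ≤ ∑' z, μ (E ∩ cube n z) := by
  refine le_trans (measure_mono fun x hx => ?_) (measure_iUnion_le _)
  exact Set.mem_iUnion.2 ⟨_, hx, mem_cube_cubeIdx n x⟩

variable [BorelSpace X]

theorem measurable_cubeIdx (n : ℕ) : Measurable (cubeIdx n : X → _) := by
  refine measurable_pi_lambda _ fun i => Int.measurable_floor.comp ?_
  have : Continuous fun x : X => (2 : ℝ) ^ n * (stdOrthonormalBasis ℝ X).repr x i := by
    simp only [OrthonormalBasis.repr_apply_apply]
    fun_prop
  exact this.measurable

theorem measurableSet_cube (n : ℕ) (z) : MeasurableSet (cube n z : Set X) :=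
  measurable_cubeIdx n (measurableSet_singleton z)

theorem tsum_measure_cube (μ : Measure X) (n : ℕ) : ∑' z, μ (cube n z) = μ Set.univ := by
  rw [← measure_iUnion (fun z w h => Set.disjoint_left.2 fun x hx hy => h (hx.symm.trans hy))
    (measurableSet_cube n)]
  congr 1
  exact Set.eq_univ_of_forall fun x => Set.mem_iUnion.2 ⟨_, mem_cube_cubeIdx n x⟩

/-- Borel–Cantelli with geometric bounds. -/
theorem ae_eventually_notMem_of_le_geometric {Ω : Type*} [MeasurableSpace Ω] {μ : Measure Ω}
    {E : ℕ → Set Ω} {C q : ENNReal} (hC : C ≠ ⊤) (hq : q < 1) (h : ∀ n, μ (E n) ≤ C * q ^ n) :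
    ∀ᵐ x ∂μ, ∀ᶠ n in atTop, x ∉ E n := by
  refine ae_eventually_notMem (ne_top_of_le_ne_top ?_ (ENNReal.tsum_le_tsum h))
  rw [ENNReal.tsum_mul_left, ENNReal.tsum_geometric]
  refine ENNReal.mul_ne_top hC (ENNReal.inv_ne_top.2 ?_)
  exact (tsub_pos_of_lt hq).ne'

/-- Almost every point is a point of weak doubling along the dyadic cubes. -/
theorem ae_eventually_pow_mul_measure_ball_le (μ : Measure X) [IsProbabilityMeasure μ] (N : ℕ)
    {q : ENNReal} (hq : q < 1) :
    ∀ᵐ y ∂μ, ∀ᶠ n in atTop,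
      q ^ n * μ (Metric.ball y (N * (1 / 2 : ℝ) ^ n)) ≤ μ (cube n (cubeIdx n y)) := by
  have := ae_eventually_notMem_of_le_geometric (μ := μ) (q := q) (C := (idxBox X N).card)
    (E := fun n => {y | μ (cube n (cubeIdx n y)) < q ^ n * μ (Metric.ball y (N * (1 / 2 : ℝ) ^ n))})
    (by simp) hq fun n => ?_
  · filter_upwards [this] with y hy
    filter_upwards [hy] with n hn
    exact not_lt.1 hn
  refine (measure_le_tsum_inter_cube μ n _).trans ?_
  have key : ∀ z, μ ({y | μ (cube n (cubeIdx n y)) <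
      q ^ n * μ (Metric.ball y (N * (1 / 2 : ℝ) ^ n))} ∩ cube n z) ≤
      q ^ n * ∑ w ∈ idxBox X N, μ (cube n (z + w)) := by
    intro z
    rcases Set.eq_empty_or_nonempty ({y | μ (cube n (cubeIdx n y)) <
      q ^ n * μ (Metric.ball y (N * (1 / 2 : ℝ) ^ n))} ∩ cube n z) with h | ⟨y, hy, rfl⟩
    · rw [h]; simp
    -- A single bad point `y` makes its whole cube light compared with the ball about `y`, which is
    -- covered by boundedly many neighbouring cubes.
    refine (measure_mono Set.inter_subset_right).trans (hy.le.trans ?_)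
    gcongr
    exact (measure_mono (ball_subset_iUnion_cube n N y)).trans (measure_biUnion_finset_le _ _)
  refine (ENNReal.tsum_le_tsum key).trans ?_
  rw [ENNReal.tsum_mul_left, Summable.tsum_finsetSum fun _ _ => ENNReal.summable]
  -- After exchanging the sums, each shift `w` runs once through all the cubes.
  have : ∀ w, ∑' z, μ (cube n (z + w)) = 1 := fun w => by
    rw [← measure_univ (μ := μ), ← tsum_measure_cube μ n]
    exact (Equiv.addRight w).tsum_eq fun z => μ (cube n z)
  simp [this, mul_comm]

end Cubes


/-! ### Upper bound for return times from invariance alone. -/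

section ReturnTime

theorem returnTime_le {X : Type*} [PseudoMetricSpace X] {f : X → X} {r : ℝ} {x : X} {n : ℕ}
    (hn : 1 ≤ n) (h : dist (f^[n] x) x < r) : returnTime f r x ≤ n :=
  sInf_le ⟨n, rfl, hn, h⟩

theorem one_le_returnTime {X : Type*} [PseudoMetricSpace X] (f : X → X) (r : ℝ) (x : X) :
    1 ≤ returnTime f r x :=
  le_sInf <| by rintro _ ⟨n, rfl, hn, -⟩; exact_mod_cast hn

theorem returnTime_anti {X : Type*} [PseudoMetricSpace X] (f : X → X) (x : X) {r s : ℝ}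
    (h : r ≤ s) : returnTime f s x ≤ returnTime f r x :=
  sInf_le_sInf <| by rintro _ ⟨n, rfl, hn, hd⟩; exact ⟨n, rfl, hn, hd.trans_le h⟩

theorem returnTime_eq_top_or_exists {X : Type*} [PseudoMetricSpace X] (f : X → X) (r : ℝ) (x : X) :
    returnTime f r x = ⊤ ∨
      ∃ n : ℕ, returnTime f r x = n ∧ 1 ≤ n ∧ dist (f^[n] x) x < r := by
  rcases Set.eq_empty_or_nonempty
    {k : ℕ∞ | ∃ n : ℕ, k = (n : ℕ∞) ∧ 1 ≤ n ∧ dist (f^[n] x) x < r} with h | h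
  · left; rw [returnTime, h, sInf_empty]
  · right; exact csInf_mem h

theorem le_dist_of_lt_returnTime {X : Type*} [PseudoMetricSpace X] {f : X → X} {r : ℝ} {x : X}
    {n : ℕ} (hn : 1 ≤ n) (h : n < returnTime f r x) : r ≤ dist (f^[n] x) x := by
  by_contra! hd
  exact (returnTime_le hn hd).not_gt h

variable {X : Type*} [PseudoMetricSpace X] [SecondCountableTopology X] [MeasurableSpace X]
  [BorelSpace X] {f : X → X} {μ : Measure X}

theorem measurable_dist_iterate (hf : Measurable f) (n : ℕ) :
    Measurable fun y => dist (f^[n] y) y :=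
  (hf.iterate n).dist measurable_id

/-- A form of Kac's lemma: few points of a small set take long to return close to themselves. -/
theorem succ_mul_measure_inter_lt_returnTime_le [IsProbabilityMeasure μ]
    (hf : MeasurePreserving f μ μ) {r : ℝ} {Q : Set X} (hQ : MeasurableSet Q)
    (hd : ∀ x ∈ Q, ∀ y ∈ Q, dist x y < r) (N : ℕ) :
    ((N + 1 : ℕ) : ENNReal) * μ ({y | N < returnTime f r y} ∩ Q) ≤ 1 := by
  -- A measurable superset of the set to be estimated, involving only the first `N` iterates.
  set W : Set X := Q ∩ ⋂ j ∈ Finset.Icc 1 N, {y | r ≤ dist (f^[j] y) y} with hW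
  have hWm : MeasurableSet W := hQ.inter <| Finset.measurableSet_biInter _ fun j _ =>
    measurableSet_le measurable_const (measurable_dist_iterate hf.measurable j)
  have hsub : {y | N < returnTime f r y} ∩ Q ⊆ W := by
    rintro y ⟨hy, hyQ⟩
    refine ⟨hyQ, Set.mem_iInter₂.2 fun j hj => ?_⟩
    rw [Finset.mem_Icc] at hj
    refine le_dist_of_lt_returnTime hj.1 (lt_of_le_of_lt ?_ hy)
    exact_mod_cast hj.2
  refine (mul_le_mul_right (measure_mono hsub) _).trans ?_
  by_contra! h
  rw [← measure_univ (μ := μ)] at h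
  -- Otherwise the `N + 1` preimages of `W` under the iterates 0, …, `N` have total mass above 1.
  -- They cannot be disjoint, so a point of `W` is back in `W`, hence `r`-close to itself, by time
  -- `N`.
  obtain ⟨x, hx, m, hm, hmx⟩ :=
    hf.exists_mem_iterate_mem_of_measure_univ_lt_mul_measure hWm.nullMeasurableSet h
  have h1 := Set.mem_iInter₂.1 hx.2 m (Finset.mem_Icc.2 ⟨hm.1, Nat.lt_succ_iff.1 hm.2⟩)
  exact (hd _ hmx.1 _ hx.1).not_ge h1

/-- Kac's bound with `N` the integer part of 1 / (c μ(Q)). The bound is proportional to μ(Q), so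
that summing over a partition into cubes costs no factor for their number. -/
theorem measure_inter_lt_mul_returnTime_le [IsProbabilityMeasure μ]
    (hf : MeasurePreserving f μ μ) {r : ℝ} {Q : Set X} (hQ : MeasurableSet Q)
    (hd : ∀ x ∈ Q, ∀ y ∈ Q, dist x y < r) {c : ENNReal} (hc : c ≠ 0) (hc' : c ≠ ⊤) :
    μ ({y | 1 < c * μ Q * (returnTime f r y : ENNReal)} ∩ Q) ≤ c * μ Q := by
  rcases eq_or_ne (μ Q) 0 with h0 | h0
  · exact (measure_mono Set.inter_subset_right).trans (by simp [h0])
  set t := c * μ Q with ht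
  have ht0 : t ≠ 0 := mul_ne_zero hc h0
  have htt : t ≠ ⊤ := ENNReal.mul_ne_top hc' (measure_ne_top _ _)
  set N := ⌊t⁻¹.toReal⌋₊ with hN
  have hN1 : (N : ENNReal) ≤ t⁻¹ := by
    rw [← ENNReal.ofReal_toReal (ENNReal.inv_ne_top.2 ht0), ← ENNReal.ofReal_natCast]
    exact ENNReal.ofReal_le_ofReal (Nat.floor_le ENNReal.toReal_nonneg)
  have hN2 : t⁻¹ ≤ ((N + 1 : ℕ) : ENNReal) := by
    rw [← ENNReal.ofReal_toReal (ENNReal.inv_ne_top.2 ht0), ← ENNReal.ofReal_natCast]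
    refine ENNReal.ofReal_le_ofReal ?_
    push_cast
    exact (Nat.lt_floor_add_one _).le
  have hsub : {y | 1 < t * (returnTime f r y : ENNReal)} ∩ Q ⊆
      {y | N < returnTime f r y} ∩ Q := by
    rintro y ⟨hy, hyQ⟩
    refine ⟨?_, hyQ⟩
    have h1 : t⁻¹ < (returnTime f r y : ENNReal) := by
      rw [ENNReal.inv_lt_iff_inv_lt, ← one_div]
      refine ENNReal.div_lt_of_lt_mul ?_
      exact hy
    have h2 := hN1.trans_lt h1
    exact_mod_cast h2
  refine (measure_mono hsub).trans ?_
  have h3 := succ_mul_measure_inter_lt_returnTime_le hf hQ hd N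
  have h4 := (mul_le_mul_left hN2 _).trans h3
  rw [mul_comm, ← div_eq_mul_inv, ENNReal.div_le_iff ht0 htt, one_mul] at h4
  exact h4

end ReturnTime

section

variable {X : Type*} [NormedAddCommGroup X] [InnerProductSpace ℝ X] [FiniteDimensional ℝ X]
  [MeasurableSpace X] [BorelSpace X] {f : X → X} {μ : Measure X}

theorem ae_eventually_pow_mul_measure_cube_mul_returnTime_le [IsProbabilityMeasure μ]
    (hf : MeasurePreserving f μ μ) {q : ENNReal} (hq0 : q ≠ 0) (hq : q < 1) :
    ∀ᵐ y ∂μ, ∀ᶠ n in atTop, q ^ n * μ (cube n (cubeIdx n y)) *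
      (returnTime f (2 ^ Module.finrank ℝ X * (1 / 2 : ℝ) ^ n) y : ENNReal) ≤ 1 := by
  have := ae_eventually_notMem_of_le_geometric (μ := μ) (q := q) (C := 1)
    (E := fun n => {y | 1 < q ^ n * μ (cube n (cubeIdx n y)) *
      (returnTime f (2 ^ Module.finrank ℝ X * (1 / 2 : ℝ) ^ n) y : ENNReal)})
    (by simp) hq fun n => ?_
  · filter_upwards [this] with y hy
    filter_upwards [hy] with n hn
    exact not_lt.1 hn
  refine (measure_le_tsum_inter_cube μ n _).trans ?_
  have key : ∀ z, μ ({y | 1 < q ^ n * μ (cube n (cubeIdx n y)) *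
      (returnTime f (2 ^ Module.finrank ℝ X * (1 / 2 : ℝ) ^ n) y : ENNReal)} ∩ cube n z) ≤
      q ^ n * μ (cube n z) := by
    intro z
    refine (measure_mono ?_).trans
      (measure_inter_lt_mul_returnTime_le hf (measurableSet_cube n z)
        (r := 2 ^ Module.finrank ℝ X * (1 / 2 : ℝ) ^ n)
        (fun x hx y hy => dist_lt_of_cubeIdx_eq (hx.trans hy.symm)) (pow_ne_zero n hq0)
        (ENNReal.pow_ne_top hq.ne_top))
    rintro y ⟨hy, rfl⟩
    exact ⟨hy, rfl⟩
  refine (ENNReal.tsum_le_tsum key).trans ?_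
  rw [ENNReal.tsum_mul_left, tsum_measure_cube, measure_univ, one_mul, mul_one]

end


/-! ### Lipschitz cutoffs and the decay of correlations. -/

section Bump

variable {X : Type*} [PseudoMetricSpace X]

/-- The Lipschitz cutoff equal to `1` on the ball of radius `ρ` and to `0` off that of radius
`2ρ`. -/
noncomputable def cutoff (c : X) (ρ : ℝ) (x : X) : ℝ := max 0 (min 1 (2 - dist x c / ρ))

theorem cutoff_nonneg (c : X) (ρ : ℝ) (x : X) : 0 ≤ cutoff c ρ x := le_max_left _ _

theorem cutoff_le_one (c : X) (ρ : ℝ) (x : X) : cutoff c ρ x ≤ 1 :=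
  max_le zero_le_one (min_le_left _ _)

theorem cutoff_eq_one {c : X} {ρ : ℝ} (hρ : 0 < ρ) {x : X} (hx : dist x c ≤ ρ) :
    cutoff c ρ x = 1 := by
  have : dist x c / ρ ≤ 1 := (div_le_one hρ).2 hx
  rw [cutoff, min_eq_left (by linarith), max_eq_right zero_le_one]

theorem cutoff_eq_zero {c : X} {ρ : ℝ} (hρ : 0 < ρ) {x : X} (hx : 2 * ρ ≤ dist x c) :
    cutoff c ρ x = 0 := by
  have : 2 ≤ dist x c / ρ := (le_div_iff₀ hρ).2 hx
  exact max_eq_left ((min_le_right _ _).trans (by linarith))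

theorem lipschitzWith_cutoff (c : X) {ρ : ℝ} (hρ : 0 < ρ) :
    LipschitzWith (ρ⁻¹).toNNReal (cutoff c ρ) := by
  refine LipschitzWith.const_max (LipschitzWith.const_min ?_ 1) 0
  refine LipschitzWith.of_dist_le_mul fun x y => ?_
  rw [Real.coe_toNNReal _ (inv_nonneg.2 hρ.le), Real.dist_eq,
    show 2 - dist x c / ρ - (2 - dist y c / ρ) = ρ⁻¹ * (dist y c - dist x c) by ring, abs_mul,
    abs_of_pos (inv_pos.2 hρ), dist_comm x y]
  gcongr
  exact abs_dist_sub_le _ _ _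

theorem isBoundedLipschitz_cutoff (c : X) {ρ : ℝ} (hρ : 0 < ρ) :
    IsBoundedLipschitz (cutoff c ρ) :=
  ⟨⟨_, lipschitzWith_cutoff c hρ⟩, 1, fun x => by
    rw [abs_of_nonneg (cutoff_nonneg _ _ _)]; exact cutoff_le_one _ _ _⟩

theorem lipNorm_nonneg (φ : X → ℝ) : 0 ≤ lipNorm φ :=
  add_nonneg (Real.iSup_nonneg fun _ => abs_nonneg _) NNReal.zero_le_coe

theorem lipNorm_cutoff_le (c : X) {ρ : ℝ} (hρ : 0 < ρ) : lipNorm (cutoff c ρ) ≤ 1 + ρ⁻¹ := by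
  have : Nonempty X := ⟨c⟩
  refine add_le_add (ciSup_le fun x => ?_) ?_
  · rw [abs_of_nonneg (cutoff_nonneg _ _ _)]; exact cutoff_le_one _ _ _
  · rw [← Real.coe_toNNReal _ (inv_nonneg.2 hρ.le), NNReal.coe_le_coe]
    exact csInf_le (OrderBot.bddBelow _) (lipschitzWith_cutoff c hρ)

theorem tsupport_cutoff_subset (c : X) {ρ : ℝ} (hρ : 0 < ρ) :
    tsupport (cutoff c ρ) ⊆ Metric.closedBall c (2 * ρ) := by
  refine closure_minimal (fun x hx => ?_) Metric.isClosed_closedBall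
  by_contra! h
  rw [Metric.mem_closedBall, not_le] at h
  exact hx (cutoff_eq_zero hρ h.le)

variable [MeasurableSpace X] [BorelSpace X]

theorem measurable_cutoff (c : X) {ρ : ℝ} (hρ : 0 < ρ) : Measurable (cutoff c ρ) :=
  (lipschitzWith_cutoff c hρ).continuous.measurable

theorem integral_cutoff_le (μ : Measure X) [IsFiniteMeasure μ] (c : X) {ρ : ℝ} (hρ : 0 < ρ) :
    ∫ x, cutoff c ρ x ∂μ ≤ μ.real (Metric.ball c (2 * ρ)) := by
  rw [← integral_indicator_one Metric.isOpen_ball.measurableSet]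
  refine integral_mono_of_nonneg (ae_of_all _ (cutoff_nonneg c ρ))
    ((integrable_const 1).indicator Metric.isOpen_ball.measurableSet) (ae_of_all _ fun x => ?_)
  by_cases hx : x ∈ Metric.ball c (2 * ρ)
  · simpa [Set.indicator_of_mem hx] using cutoff_le_one c ρ x
  · rw [Metric.mem_ball, not_lt] at hx
    simp only [cutoff_eq_zero hρ hx]
    exact Set.indicator_nonneg (fun _ _ => zero_le_one) _

/-- Local decay of correlations bounds the measure of the points of a ball which are back in it at
time `k`. -/
theorem measure_ball_inter_preimage_iterate_le {f : X → X} {μ : Measure X} [IsProbabilityMeasure μ]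
    (hf : Measurable f) {V : Set X} {θ : ℕ → ℝ}
    (hdec : ∀ φ ψ : X → ℝ, IsBoundedLipschitz φ → IsBoundedLipschitz ψ →
        tsupport φ ⊆ V → tsupport ψ ⊆ V → ∀ n : ℕ,
          |(∫ x, φ (f^[n] x) * ψ x ∂μ) - (∫ x, φ x ∂μ) * ∫ x, ψ x ∂μ|
            ≤ lipNorm φ * lipNorm ψ * θ n)
    {c : X} {ρ : ℝ} (hρ : 0 < ρ) (hV : Metric.closedBall c (2 * ρ) ⊆ V) (k : ℕ) :
    μ {y | dist y c ≤ ρ ∧ dist (f^[k] y) c ≤ ρ} ≤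
      μ (Metric.ball c (2 * ρ)) ^ 2 + ENNReal.ofReal ((1 + ρ⁻¹) ^ 2 * |θ k|) := by
  set φ := cutoff c ρ with hφ
  have hm := measurable_cutoff c hρ
  have h1 := hdec φ φ (isBoundedLipschitz_cutoff c hρ) (isBoundedLipschitz_cutoff c hρ)
    ((tsupport_cutoff_subset c hρ).trans hV) ((tsupport_cutoff_subset c hρ).trans hV) k
  have h2 : lipNorm φ * lipNorm φ * θ k ≤ (1 + ρ⁻¹) ^ 2 * |θ k| := by
    rw [sq]
    have := lipNorm_cutoff_le c hρ
    have h0 := lipNorm_nonneg (cutoff c ρ)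
    exact (mul_le_mul_of_nonneg_left (le_abs_self _) (mul_nonneg h0 h0)).trans
      (mul_le_mul_of_nonneg_right (mul_le_mul this this h0 (h0.trans this)) (abs_nonneg _))
  have h3 : (∫ x, φ x ∂μ) * ∫ x, φ x ∂μ ≤ μ.real (Metric.ball c (2 * ρ)) ^ 2 := by
    rw [sq]
    have := integral_cutoff_le μ c hρ
    have h0 : 0 ≤ ∫ x, φ x ∂μ := integral_nonneg (cutoff_nonneg c ρ)
    exact mul_le_mul this this h0 (h0.trans this)
  have hg0 : ∀ x, 0 ≤ φ (f^[k] x) * φ x := fun x =>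
    mul_nonneg (cutoff_nonneg _ _ _) (cutoff_nonneg _ _ _)
  have hint : Integrable (fun x => φ (f^[k] x) * φ x) μ := by
    refine Integrable.of_bound (C := 1) ((hm.comp (hf.iterate k)).mul hm).aestronglyMeasurable
      (ae_of_all _ fun x => ?_)
    rw [Real.norm_eq_abs, abs_of_nonneg (hg0 x)]
    exact mul_le_one₀ (cutoff_le_one _ _ _) (cutoff_nonneg _ _ _) (cutoff_le_one _ _ _)
  -- Markov's inequality at level 1: both factors equal 1 when `y` and its `k`-th iterate lie within
  -- `ρ` of `c`.
  have h4 := mul_meas_ge_le_integral_of_nonneg (ae_of_all _ hg0) hint 1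
  rw [one_mul] at h4
  have h5 : {y | dist y c ≤ ρ ∧ dist (f^[k] y) c ≤ ρ} ⊆ {x | 1 ≤ φ (f^[k] x) * φ x} := by
    rintro y ⟨hy1, hy2⟩
    simp [hφ, cutoff_eq_one hρ hy1, cutoff_eq_one hρ hy2]
  refine (measure_mono h5).trans ?_
  rw [← ofReal_measureReal, ← ofReal_measureReal (s := Metric.ball c (2 * ρ)),
    ← ENNReal.ofReal_pow measureReal_nonneg, ← ENNReal.ofReal_add (by positivity) (by positivity)]
  refine ENNReal.ofReal_le_ofReal ?_
  have := (abs_le.1 h1).2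
  linarith

end Bump

theorem IsSuperPolynomiallySmall.exists_bound {θ : ℕ → ℝ} (h : IsSuperPolynomiallySmall θ)
    {L : ℕ} (hL : 0 < L) : ∃ B : ℝ, 0 ≤ B ∧ ∀ k : ℕ, (k : ℝ) ^ L * |θ k| ≤ B := by
  have h1 := (h L (by exact_mod_cast hL)).abs.bddAbove_range
  obtain ⟨B, hB⟩ := h1
  refine ⟨B, (abs_nonneg _).trans (hB ⟨0, rfl⟩), fun k => ?_⟩
  have := hB ⟨k, rfl⟩
  simp only [Real.rpow_natCast, abs_mul] at this
  rwa [abs_of_nonneg (by positivity : (0 : ℝ) ≤ (k : ℝ) ^ L)] at this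

/-- The tail of the decay rates from the time `2 ^ (n / A)` on is smaller than any prescribed power
of `2⁻ⁿ`. -/
theorem IsSuperPolynomiallySmall.exists_sum_le {θ : ℕ → ℝ} (h : IsSuperPolynomiallySmall θ)
    (A J : ℕ) : ∃ B : ℝ, 0 ≤ B ∧ ∀ n : ℕ, ∀ F : Finset ℕ, (∀ k ∈ F, 1 ≤ k ∧ 2 ^ n ≤ k ^ A) →
      ∑ k ∈ F, |θ k| ≤ B * ((1 / 2 : ℝ) ^ n) ^ J := by
  -- Since k ^ A ≥ 2 ^ n, the power A * J yields the factor 2 ^ (-n * J); the extra 2 makes the sum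
  -- over `k` converge.
  obtain ⟨B, hB0, hB⟩ := h.exists_bound (L := A * J + 2) (by omega)
  have hs : Summable fun k : ℕ => 1 / (k : ℝ) ^ 2 := Real.summable_one_div_nat_pow.2 one_lt_two
  refine ⟨B * ∑' k : ℕ, 1 / (k : ℝ) ^ 2, mul_nonneg hB0 (tsum_nonneg fun _ => by positivity),
    fun n F hF => ?_⟩
  have h1 : ∀ k ∈ F, |θ k| ≤ B * ((1 / 2 : ℝ) ^ n) ^ J * (1 / (k : ℝ) ^ 2) := by
    intro k hk
    obtain ⟨hk1, hk2⟩ := hF k hk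
    have hk0 : (0 : ℝ) < k := by exact_mod_cast hk1
    have h2 : ((2 : ℝ) ^ n) ^ J ≤ (k : ℝ) ^ (A * J) := by
      rw [pow_mul]
      gcongr
      exact_mod_cast hk2
    have h3 : ((2 : ℝ) ^ n) ^ J * (k : ℝ) ^ 2 * |θ k| ≤ B := by
      refine le_trans ?_ (hB k)
      rw [pow_add]
      gcongr
    rw [one_div, inv_pow, inv_pow, one_div, mul_assoc, ← mul_inv, ← div_eq_mul_inv,
      le_div_iff₀ (by positivity), mul_comm]
    exact h3
  refine (Finset.sum_le_sum h1).trans ?_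
  rw [← Finset.mul_sum, mul_right_comm]
  gcongr
  exact hs.sum_le_tsum _ fun _ _ => by positivity


/-! ### Early returns are rare. -/

section Mixing

variable {X : Type*} [NormedAddCommGroup X] [InnerProductSpace ℝ X] [FiniteDimensional ℝ X]
  [MeasurableSpace X] [BorelSpace X] {f : X → X} {μ : Measure X} [IsProbabilityMeasure μ]

/-- The points which come back `2⁻ⁿ`-close to themselves at a time `k ≥ 2 ^ (n / A)` which is
short compared with the inverse of the measure of a ball of comparable radius. -/
def earlyReturns (f : X → X) (μ : Measure X) (A : ℕ) (p : ENNReal) (n : ℕ) : Set X :=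
  {y | ∃ k : ℕ, 1 ≤ k ∧ 2 ^ n ≤ k ^ A ∧
    k * μ (Metric.ball y (2 ^ (Module.finrank ℝ X + 2) * (1 / 2 : ℝ) ^ n)) ≤ p ^ (3 * n) ∧
    dist (f^[k] y) y < (1 / 2 : ℝ) ^ n}

/-- With `w` the mass of the cube and `b` that of the ball of radius 2ρ, early return times satisfy
k w ≤ p ^ (3n), so there are at most K ≤ p ^ (3n) / w of them, each contributing b² plus an error.
Of the exponent 3n, the part 2n pays for replacing b² by w² through `hreg`, and n remains as the
gain. -/
theorem measure_earlyReturns_inter_cube_le (hf : Measurable f) {V : Set X} {θ : ℕ → ℝ}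
    (hdec : ∀ φ ψ : X → ℝ, IsBoundedLipschitz φ → IsBoundedLipschitz ψ →
        tsupport φ ⊆ V → tsupport ψ ⊆ V → ∀ n : ℕ,
          |(∫ x, φ (f^[n] x) * ψ x ∂μ) - (∫ x, φ x ∂μ) * ∫ x, ψ x ∂μ|
            ≤ lipNorm φ * lipNorm ψ * θ n)
    {A n : ℕ} {p κ : ENNReal} (hp0 : p ≠ 0) (hp : p ≠ ⊤) {c : X}
    (hV : Metric.closedBall c (2 ^ (Module.finrank ℝ X + 2) * (1 / 2 : ℝ) ^ n) ⊆ V)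
    (hreg : p ^ n * μ (Metric.ball c (2 ^ (Module.finrank ℝ X + 2) * (1 / 2 : ℝ) ^ n)) ≤
      μ (cube n (cubeIdx n c)))
    (hκ : ∀ F : Finset ℕ, (∀ k ∈ F, 1 ≤ k ∧ 2 ^ n ≤ k ^ A) →
      ∑ k ∈ F, ENNReal.ofReal (4 * ((2 : ℝ) ^ n) ^ 2 * |θ k|) ≤ κ) :
    μ (earlyReturns f μ A p n ∩ cube n (cubeIdx n c)) ≤
      p ^ n * μ (cube n (cubeIdx n c)) + κ := by
  set d := Module.finrank ℝ X with hd
  set w := μ (cube n (cubeIdx n c)) with hw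
  rcases eq_or_ne w 0 with h0 | h0
  · refine (measure_mono Set.inter_subset_right).trans ?_
    rw [← hw, h0]; exact zero_le
  have hwt : w ≠ ⊤ := measure_ne_top _ _
  -- Room for the diameter of the cube plus the return distance 2⁻ⁿ, each at most 2 ^ d * 2⁻ⁿ.
  set ρ : ℝ := 2 ^ (d + 1) * (1 / 2 : ℝ) ^ n with hρ
  have hρ0 : 0 < ρ := by positivity
  have hρ2 : 2 ^ (d + 2) * (1 / 2 : ℝ) ^ n = 2 * ρ := by rw [hρ]; ring
  rw [hρ2] at hV hreg
  set b := μ (Metric.ball c (2 * ρ)) with hb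
  have hpt : p ^ (3 * n) / w ≠ ⊤ := ENNReal.div_ne_top (ENNReal.pow_ne_top hp) h0
  set K := ⌊(p ^ (3 * n) / w).toReal⌋₊ with hK
  set F := (Finset.Icc 1 K).filter fun k => 2 ^ n ≤ k ^ A with hF
  have hKw : K * w ≤ p ^ (3 * n) := by
    rw [← ENNReal.le_div_iff_mul_le (Or.inl h0) (Or.inl hwt), ← ENNReal.ofReal_toReal hpt,
      ← ENNReal.ofReal_natCast]
    exact ENNReal.ofReal_le_ofReal (Nat.floor_le ENNReal.toReal_nonneg)
  have hd1 : (2 : ℝ) ^ d * (1 / 2 : ℝ) ^ n ≤ 2 * ρ := by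
    rw [← hρ2]
    gcongr
    · norm_num
    · omega
  have hsub : earlyReturns f μ A p n ∩ cube n (cubeIdx n c) ⊆
      ⋃ k ∈ F, {y | dist y c ≤ ρ ∧ dist (f^[k] y) c ≤ ρ} := by
    rintro y ⟨⟨k, hk1, hk2, hk3, hk4⟩, hy⟩
    have hyc : dist y c < 2 ^ d * (1 / 2 : ℝ) ^ n := dist_lt_of_cubeIdx_eq hy
    have hge1 : (1 / 2 : ℝ) ^ n ≤ 2 ^ d * (1 / 2 : ℝ) ^ n :=
      le_mul_of_one_le_left (by positivity) (one_le_pow₀ (by norm_num))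
    have hρe : ρ = 2 ^ d * (1 / 2 : ℝ) ^ n + 2 ^ d * (1 / 2 : ℝ) ^ n := by rw [hρ]; ring
    have hpos : 0 < (1 / 2 : ℝ) ^ n := by positivity
    refine Set.mem_iUnion₂.2 ⟨k, ?_, by linarith, ?_⟩
    · rw [hF, Finset.mem_filter, Finset.mem_Icc]
      refine ⟨⟨hk1, ?_⟩, hk2⟩
      have hkw : k * w ≤ p ^ (3 * n) := by
        refine le_trans ?_ hk3
        gcongr
        rw [hw, ← show cubeIdx n y = cubeIdx n c from hy]
        refine measure_mono <| (cube_subset_ball n y).trans (Metric.ball_subset_ball ?_)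
        rw [← hd, hρ2]; exact hd1
      rw [← ENNReal.le_div_iff_mul_le (Or.inl h0) (Or.inl hwt)] at hkw
      refine Nat.le_floor ?_
      simpa using ENNReal.toReal_mono hpt hkw
    · have := dist_triangle (f^[k] y) y c
      linarith
  have hb2 : K * b ^ 2 ≤ p ^ n * w := by
    have hq0 : p ^ (2 * n) ≠ 0 := pow_ne_zero _ hp0
    have hqt : p ^ (2 * n) ≠ ⊤ := ENNReal.pow_ne_top hp
    refine (ENNReal.mul_le_mul_iff_right hq0 hqt).1 ?_
    calc p ^ (2 * n) * (K * b ^ 2) = K * (p ^ n * b) ^ 2 := by ring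
      _ ≤ K * w ^ 2 := by gcongr
      _ = K * w * w := by ring
      _ ≤ p ^ (3 * n) * w := by gcongr
      _ = p ^ (2 * n) * (p ^ n * w) := by ring
  have hcoef : (1 + ρ⁻¹) ^ 2 ≤ 4 * ((2 : ℝ) ^ n) ^ 2 := by
    have h1 : ρ⁻¹ ≤ 2 ^ n := by
      rw [hρ, mul_inv, one_div, inv_pow, inv_inv]
      exact mul_le_of_le_one_left (by positivity) (inv_le_one_of_one_le₀ (one_le_pow₀ (by norm_num)))
    have h2 : (1 : ℝ) ≤ 2 ^ n := one_le_pow₀ (by norm_num)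
    have h3 : 0 ≤ ρ⁻¹ := by positivity
    nlinarith
  calc μ (earlyReturns f μ A p n ∩ cube n (cubeIdx n c))
      ≤ ∑ k ∈ F, μ {y | dist y c ≤ ρ ∧ dist (f^[k] y) c ≤ ρ} :=
        (measure_mono hsub).trans (measure_biUnion_finset_le _ _)
    _ ≤ ∑ k ∈ F, (b ^ 2 + ENNReal.ofReal (4 * ((2 : ℝ) ^ n) ^ 2 * |θ k|)) := by
        refine Finset.sum_le_sum fun k _ =>
          (measure_ball_inter_preimage_iterate_le hf hdec hρ0 hV k).trans ?_
        gcongr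
    _ = F.card * b ^ 2 + ∑ k ∈ F, ENNReal.ofReal (4 * ((2 : ℝ) ^ n) ^ 2 * |θ k|) := by
        rw [Finset.sum_add_distrib, Finset.sum_const, nsmul_eq_mul]
    _ ≤ p ^ n * w + κ := by
        refine add_le_add (le_trans ?_ hb2) (hκ F fun k hk => ?_)
        · gcongr
          exact (Finset.card_filter_le _ _).trans (by simp)
        · rw [hF, Finset.mem_filter, Finset.mem_Icc] at hk
          exact ⟨hk.1.1, hk.2⟩

/-- The points of `V ∩ B(0, m)` where the scales below `2⁻ᵐ` are well behaved. -/
def goodPoints (μ : Measure X) (V : Set X) (p : ENNReal) (m : ℕ) : Set X :=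
  {y | Metric.closedBall y (2 ^ (Module.finrank ℝ X + 2) * (1 / 2 : ℝ) ^ m) ⊆ V ∧ ‖y‖ ≤ m ∧
    ∀ n ≥ m, p ^ n * μ (Metric.ball y (2 ^ (Module.finrank ℝ X + 2) * (1 / 2 : ℝ) ^ n)) ≤
      μ (cube n (cubeIdx n y))}

/-- The errors proportional to the mass of a cube add up to p ^ n, but `κ` is the same for every
cube. Its sum is controlled because good points lie in a bounded set, met by O(2 ^ (n d)) cubes. -/
theorem exists_measure_earlyReturns_inter_goodPoints_le (hf : Measurable f) {V : Set X}
    {θ : ℕ → ℝ} (hθ : IsSuperPolynomiallySmall θ)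
    (hdec : ∀ φ ψ : X → ℝ, IsBoundedLipschitz φ → IsBoundedLipschitz ψ →
        tsupport φ ⊆ V → tsupport ψ ⊆ V → ∀ n : ℕ,
          |(∫ x, φ (f^[n] x) * ψ x ∂μ) - (∫ x, φ x ∂μ) * ∫ x, ψ x ∂μ|
            ≤ lipNorm φ * lipNorm ψ * θ n)
    (A m : ℕ) {p : ENNReal} (hp0 : p ≠ 0) (hp : p ≠ ⊤) :
    ∃ C : ENNReal, C ≠ ⊤ ∧ ∀ n ≥ m, μ (earlyReturns f μ A p n ∩ goodPoints μ V p m) ≤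
      p ^ n + C * ENNReal.ofReal (1 / 2) ^ n := by
  set d := Module.finrank ℝ X with hd
  -- Of the d + 3 powers of 2⁻ⁿ, two offset the squared Lipschitz norm, `d` the number of cubes, and
  -- one is left for Borel–Cantelli.
  obtain ⟨B, hB0, hB⟩ := hθ.exists_sum_le A (d + 3)
  refine ⟨ENNReal.ofReal ((2 * m + 3) ^ d * (4 * B)), ENNReal.ofReal_ne_top, fun n hn => ?_⟩
  set κ : ENNReal := ENNReal.ofReal (4 * B * ((1 / 2 : ℝ) ^ n) ^ (d + 1)) with hκdef
  have hκ : ∀ F : Finset ℕ, (∀ k ∈ F, 1 ≤ k ∧ 2 ^ n ≤ k ^ A) →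
      ∑ k ∈ F, ENNReal.ofReal (4 * ((2 : ℝ) ^ n) ^ 2 * |θ k|) ≤ κ := by
    intro F hF
    rw [← ENNReal.ofReal_sum_of_nonneg fun _ _ => by positivity, ← Finset.mul_sum]
    refine ENNReal.ofReal_le_ofReal ?_
    refine (mul_le_mul_of_nonneg_left (hB n F hF) (by positivity)).trans_eq ?_
    have : (2 : ℝ) ^ n * (1 / 2 : ℝ) ^ n = 1 := by rw [← mul_pow]; norm_num
    calc 4 * ((2 : ℝ) ^ n) ^ 2 * (B * ((1 / 2 : ℝ) ^ n) ^ (d + 3))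
        = 4 * B * ((1 / 2 : ℝ) ^ n) ^ (d + 1) * ((2 : ℝ) ^ n * (1 / 2 : ℝ) ^ n) ^ 2 := by ring
      _ = _ := by rw [this]; ring
  set Z := idxBox X ((m + 1) * 2 ^ n) with hZ
  have hsub : earlyReturns f μ A p n ∩ goodPoints μ V p m ⊆
      ⋃ z ∈ Z, (earlyReturns f μ A p n ∩ goodPoints μ V p m) ∩ cube n z := by
    intro y hy
    exact Set.mem_iUnion₂.2 ⟨cubeIdx n y, cubeIdx_mem_idxBox_of_norm_le hy.2.2.1 n, hy,
      mem_cube_cubeIdx n y⟩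
  have key : ∀ z, μ ((earlyReturns f μ A p n ∩ goodPoints μ V p m) ∩ cube n z) ≤
      p ^ n * μ (cube n z) + κ := by
    intro z
    rcases Set.eq_empty_or_nonempty
      ((earlyReturns f μ A p n ∩ goodPoints μ V p m) ∩ cube n z) with h | ⟨c, ⟨-, hc⟩, rfl⟩
    · rw [h]; simp
    refine (measure_mono (Set.inter_subset_inter_left _ Set.inter_subset_left)).trans
      (measure_earlyReturns_inter_cube_le hf hdec hp0 hp ?_ (hc.2.2 n hn) hκ)
    refine (Metric.closedBall_subset_closedBall ?_).trans hc.1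
    gcongr ?_ * ?_
    exact pow_le_pow_of_le_one (by norm_num) (by norm_num) hn
  have hcard : (Z.card : ENNReal) * κ ≤
      ENNReal.ofReal ((2 * m + 3) ^ d * (4 * B)) * ENNReal.ofReal (1 / 2) ^ n := by
    rw [← ENNReal.ofReal_natCast, hκdef, ← ENNReal.ofReal_mul (by positivity),
      ← ENNReal.ofReal_pow (by norm_num), ← ENNReal.ofReal_mul (by positivity)]
    refine ENNReal.ofReal_le_ofReal ?_
    rw [hZ, card_idxBox, ← hd]
    push_cast
    have h1 : (2 : ℝ) ^ n * (1 / 2 : ℝ) ^ n = 1 := by rw [← mul_pow]; norm_num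
    have h2 : (1 : ℝ) ≤ 2 ^ n := one_le_pow₀ (by norm_num)
    calc (2 * ((m + 1) * 2 ^ n) + 1 : ℝ) ^ d * (4 * B * ((1 / 2 : ℝ) ^ n) ^ (d + 1))
        ≤ ((2 * m + 3) * 2 ^ n) ^ d * (4 * B * ((1 / 2 : ℝ) ^ n) ^ (d + 1)) := by
          gcongr
          linarith
      _ = (2 * m + 3) ^ d * (4 * B) * (1 / 2) ^ n * ((2 : ℝ) ^ n * (1 / 2 : ℝ) ^ n) ^ d := by
          rw [mul_pow, mul_pow]; ring
      _ = _ := by rw [h1]; ring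
  calc μ (earlyReturns f μ A p n ∩ goodPoints μ V p m)
      ≤ ∑ z ∈ Z, (p ^ n * μ (cube n z) + κ) :=
        (measure_mono hsub).trans ((measure_biUnion_finset_le _ _).trans
          (Finset.sum_le_sum fun z _ => key z))
    _ = p ^ n * ∑ z ∈ Z, μ (cube n z) + Z.card * κ := by
        rw [Finset.sum_add_distrib, Finset.sum_const, nsmul_eq_mul, Finset.mul_sum]
    _ ≤ p ^ n + ENNReal.ofReal ((2 * m + 3) ^ d * (4 * B)) * ENNReal.ofReal (1 / 2) ^ n := by
        refine add_le_add (mul_le_of_le_one_right' ?_) hcard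
        refine (ENNReal.sum_le_tsum Z).trans ?_
        rw [tsum_measure_cube, measure_univ]

/-- Borel–Cantelli applies on each set of good points; since `V` is open and weak doubling holds
almost everywhere, these sets exhaust `V` up to a null set. -/
theorem ae_eventually_notMem_earlyReturns (hf : Measurable f) {V : Set X} (hV : IsOpen V)
    {θ : ℕ → ℝ} (hθ : IsSuperPolynomiallySmall θ)
    (hdec : ∀ φ ψ : X → ℝ, IsBoundedLipschitz φ → IsBoundedLipschitz ψ →
        tsupport φ ⊆ V → tsupport ψ ⊆ V → ∀ n : ℕ,
          |(∫ x, φ (f^[n] x) * ψ x ∂μ) - (∫ x, φ x ∂μ) * ∫ x, ψ x ∂μ|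
            ≤ lipNorm φ * lipNorm ψ * θ n)
    (A : ℕ) {p : ENNReal} (hp0 : p ≠ 0) (hp : p < 1) :
    ∀ᵐ y ∂μ, y ∈ V → ∀ᶠ n in atTop, y ∉ earlyReturns f μ A p n := by
  have h1 : ∀ m : ℕ, ∀ᵐ y ∂μ, y ∈ goodPoints μ V p m →
      ∀ᶠ n in atTop, y ∉ earlyReturns f μ A p n := by
    intro m
    obtain ⟨C, hC, hCle⟩ :=
      exists_measure_earlyReturns_inter_goodPoints_le hf hθ hdec A m hp0 hp.ne_top
    have h2 := ae_eventually_notMem_of_le_geometric (μ := μ)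
      (q := max p (ENNReal.ofReal (1 / 2))) (C := 1 + C)
      (E := fun n => {y | m ≤ n ∧ y ∈ earlyReturns f μ A p n ∩ goodPoints μ V p m})
      (ENNReal.add_ne_top.2 ⟨ENNReal.one_ne_top, hC⟩)
      (max_lt hp (by rw [ENNReal.ofReal_lt_one]; norm_num)) fun n => ?_
    · filter_upwards [h2] with y hy hyg
      filter_upwards [hy, eventually_ge_atTop m] with n hn hmn hy'
      exact hn ⟨hmn, hy', hyg⟩
    by_cases hmn : m ≤ n
    · simp only [hmn, true_and, Set.ofPred_mem_eq]
      refine (hCle n hmn).trans ?_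
      rw [add_mul, one_mul]
      gcongr
      · exact le_max_left _ _
      · exact le_max_right _ _
    · simp [hmn]
  have h3 := ae_eventually_pow_mul_measure_ball_le μ (2 ^ (Module.finrank ℝ X + 2)) hp
  filter_upwards [ae_all_iff.2 h1, h3] with y hy hreg hyV
  obtain ⟨δ, hδ, hball⟩ := Metric.isOpen_iff.1 hV y hyV
  obtain ⟨a, ha⟩ := eventually_atTop.1 hreg
  have hlim : Tendsto (fun m : ℕ => (2 : ℝ) ^ (Module.finrank ℝ X + 2) * (1 / 2 : ℝ) ^ m) atTop
      (𝓝 0) := by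
    simpa using (tendsto_pow_atTop_nhds_zero_of_lt_one (by norm_num)
      (by norm_num : (1 / 2 : ℝ) < 1)).const_mul ((2 : ℝ) ^ (Module.finrank ℝ X + 2))
  obtain ⟨m, hm1, hm2, hm3⟩ := ((hlim.eventually_lt_const hδ).and
    ((eventually_ge_atTop a).and (eventually_ge_atTop ⌈‖y‖⌉₊))).exists
  refine hy m ⟨(Metric.closedBall_subset_ball hm1).trans hball,
    (Nat.le_ceil _).trans (by exact_mod_cast hm3), fun n hn => ?_⟩
  simpa using ha n (hm2.trans hn)

end Mixing


/-! ### From two-sided product bounds to rates and dimensions. -/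

section Rates

theorem tendsto_half_pow_nhdsGT_zero :
    Tendsto (fun n : ℕ => (1 / 2 : ℝ) ^ n) atTop (𝓝[>] 0) :=
  tendsto_nhdsWithin_iff.2 ⟨tendsto_pow_atTop_nhds_zero_of_lt_one (by norm_num) (by norm_num),
    Eventually.of_forall fun _ => by simp⟩

theorem eventually_nhdsGT_zero_exists_dyadic {P : ℕ → ℝ → Prop}
    (h : ∀ᶠ l in atTop, ∀ r ∈ Set.Ioc ((1 / 2 : ℝ) ^ (l + 1)) ((1 / 2) ^ l), P l r) :
    ∀ᶠ r in 𝓝[>] (0 : ℝ), ∃ l, 1 ≤ l ∧ r ≤ (1 / 2) ^ l ∧ P l r := by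
  obtain ⟨a, ha⟩ := eventually_atTop.1 h
  -- The exponent `a + 1` rather than `a` forces l > a, which gives 1 ≤ l even when a = 0.
  have hpos : (0 : ℝ) < (1 / 2) ^ (a + 1) := by positivity
  filter_upwards [Ioo_mem_nhdsGT hpos] with r hr
  have hle : ((1 : ℝ) / 2) ^ (a + 1) ≤ 1 := pow_le_one₀ (by norm_num) (by norm_num)
  obtain ⟨l, hl1, hl2⟩ := exists_nat_pow_near_of_lt_one (y := (1 / 2 : ℝ)) hr.1 (hr.2.le.trans hle)
    (by norm_num) (by norm_num)
  have hal : a + 1 < l + 1 :=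
    (pow_lt_pow_iff_right_of_lt_one₀ (by norm_num) (by norm_num)).1 (hl1.trans hr.2)
  exact ⟨l, by omega, hl2, ha l (by omega) r ⟨hl1, hl2⟩⟩

theorem liminf_le_liminf_of_eventually_le_add {α : Type*} {F : Filter α} {u v : α → EReal}
    (h : ∀ ε : ℝ, 0 < ε → ∀ᶠ a in F, u a ≤ v a + ε) : liminf u F ≤ liminf v F := by
  refine le_of_forall_lt fun c hc => ?_
  obtain ⟨x, hcx, hx⟩ := EReal.lt_iff_exists_real_btwn.1 hc
  obtain ⟨x', hxx', hx'⟩ := EReal.lt_iff_exists_real_btwn.1 hx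
  refine hcx.trans_le (le_liminf_of_le (by isBoundedDefault) ?_)
  filter_upwards [eventually_lt_of_lt_liminf hx',
    h (x' - x) (sub_pos.2 (EReal.coe_lt_coe_iff.1 hxx'))] with a h1 h2
  have h3 := h1.le.trans h2
  rw [show (x' : EReal) = x + ((x' - x : ℝ) : EReal) by
    rw [← EReal.coe_add, add_sub_cancel]] at h3
  exact (EReal.addLECancellable_coe _).add_le_add_iff_right.1 h3

theorem limsup_le_limsup_of_eventually_le_add {α : Type*} {F : Filter α} {u v : α → EReal}
    (h : ∀ ε : ℝ, 0 < ε → ∀ᶠ a in F, u a ≤ v a + ε) : limsup u F ≤ limsup v F := by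
  refine le_of_forall_gt fun c hc => ?_
  obtain ⟨x, hx, hxc⟩ := EReal.lt_iff_exists_real_btwn.1 hc
  obtain ⟨x', hx', hxx'⟩ := EReal.lt_iff_exists_real_btwn.1 hx
  refine lt_of_le_of_lt (limsup_le_of_le (by isBoundedDefault) ?_) hxc
  filter_upwards [eventually_lt_of_limsup_lt hx',
    h (x - x') (sub_pos.2 (EReal.coe_lt_coe_iff.1 hxx'))] with a h1 h2
  refine h2.trans ((add_le_add_left h1.le _).trans_eq ?_)
  rw [← EReal.coe_add, add_sub_cancel]

variable {X : Type*} [PseudoMetricSpace X]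

/-- A positive lower recurrence rate rules out returns at polynomially small times. -/
theorem exists_pow_le_pow_of_lowerRecurrenceRate_pos {f : X → X} {y : X}
    (h : 0 < lowerRecurrenceRate f y) :
    ∃ A : ℕ, ∀ᶠ n in atTop, ∀ k : ℕ, 1 ≤ k → dist (f^[k] y) y < (1 / 2 : ℝ) ^ n →
      2 ^ n ≤ k ^ A := by
  obtain ⟨a, ha0, ha⟩ := EReal.lt_iff_exists_real_btwn.1 h
  rw [← EReal.coe_zero, EReal.coe_lt_coe_iff] at ha0
  -- Return times at scale 2⁻ⁿ are eventually at least 2 ^ (a n), and raising to a power A ≥ 1 / a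
  -- gives 2 ^ n.
  refine ⟨⌈1 / a⌉₊, ?_⟩
  filter_upwards [tendsto_half_pow_nhdsGT_zero.eventually (eventually_lt_of_lt_liminf ha),
    eventually_ge_atTop 1] with n hn hn1 k hk hd
  have hk0 : (0 : ℝ) < k := by exact_mod_cast hk
  have hL : Real.log (1 / (1 / 2 : ℝ) ^ n) = n * Real.log 2 := by
    rw [one_div, one_div, inv_pow, inv_inv, Real.log_pow]
  have hL0 : 0 < (n : ℝ) * Real.log 2 :=
    mul_pos (by exact_mod_cast hn1) (Real.log_pos one_lt_two)
  have h1 : ENNReal.log (returnTime f ((1 / 2 : ℝ) ^ n) y : ENNReal) ≤ (Real.log k : ℝ) := by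
    rw [← ENNReal.log_ofReal_of_pos hk0, ENNReal.ofReal_natCast]
    refine ENNReal.log_le_log ?_
    exact_mod_cast returnTime_le hk hd
  have h2 := (EReal.le_div_iff_mul_le (by exact_mod_cast hL0) (EReal.coe_ne_top _)).1 (hL ▸ hn.le)
  have h3 : a * (n * Real.log 2) ≤ Real.log k := by exact_mod_cast h2.trans h1
  have h4 : 1 ≤ (⌈1 / a⌉₊ : ℝ) * a := (div_le_iff₀ ha0).1 (Nat.le_ceil _)
  have h5 : (n : ℝ) * Real.log 2 ≤ ⌈1 / a⌉₊ * Real.log k := by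
    calc (n : ℝ) * Real.log 2 ≤ (⌈1 / a⌉₊ * a) * (n * Real.log 2) :=
          le_mul_of_one_le_left hL0.le h4
      _ = ⌈1 / a⌉₊ * (a * (n * Real.log 2)) := by ring
      _ ≤ _ := by gcongr
  rw [← Real.log_pow, ← Real.log_pow, Real.log_le_log_iff (by positivity) (by positivity)] at h5
  exact_mod_cast h5

theorem ae_forall_measure_ball_pos [SecondCountableTopology X] [MeasurableSpace X] (μ : Measure X) :
    ∀ᵐ y ∂μ, ∀ r > 0, 0 < μ (Metric.ball y r) := by
  filter_upwards [Measure.support_mem_ae (μ := μ)] with y hy r hr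
  exact (Measure.mem_support_iff_forall y).1 hy _ (Metric.ball_mem_nhds y hr)

/-- If the return time to a small ball and the measure of the ball are inverse to each other up to
subexponential errors, the recurrence rates are the pointwise dimensions. -/
theorem rates_eq_dims_of_eventually [MeasurableSpace X] {μ : Measure X} [IsProbabilityMeasure μ]
    {f : X → X} {y : X} (hpos : ∀ r > 0, 0 < μ (Metric.ball y r))
    (hub : ∀ j : ℕ, ∀ᶠ l in atTop, ∀ r ∈ Set.Ioc ((1 / 2 : ℝ) ^ (l + 1)) ((1 / 2) ^ l),
      ENNReal.ofReal (Real.exp (-(1 / (j + 1)))) ^ (5 * l) *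
        ((returnTime f r y : ENNReal) * μ (Metric.ball y r)) ≤ 1)
    (hlb : ∀ j : ℕ, ∀ᶠ l in atTop, ∀ r ∈ Set.Ioc ((1 / 2 : ℝ) ^ (l + 1)) ((1 / 2) ^ l),
      ENNReal.ofReal (Real.exp (-(1 / (j + 1)))) ^ (5 * l) ≤
        (returnTime f r y : ENNReal) * μ (Metric.ball y r)) :
    lowerRecurrenceRate f y = lowerPointwiseDim μ y ∧
      upperRecurrenceRate f y = upperPointwiseDim μ y := by
  have key : ∀ ε : ℝ, 0 < ε → ∀ᶠ r : ℝ in 𝓝[>] (0 : ℝ), ∃ u v : ℝ,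
      ENNReal.log (returnTime f r y : ENNReal) / (Real.log (1 / r) : EReal) = u ∧
      ENNReal.log (μ (Metric.ball y r)) / (Real.log r : EReal) = v ∧ |u - v| ≤ ε := by
    intro ε hε
    -- The logarithmic error is 5 l δ while log (1 / r) ≥ l log 2 ≥ l / 2, so the quotients differ
    -- by at most 10 δ.
    obtain ⟨j, hj⟩ := exists_nat_one_div_lt (show (0 : ℝ) < ε / 10 by positivity)
    set δ : ℝ := 1 / (j + 1) with hδ
    have hδ0 : 0 < δ := by positivity
    filter_upwards [eventually_nhdsGT_zero_exists_dyadic ((hub j).and (hlb j) |>.mono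
      fun l h r hr => And.intro (h.1 r hr) (h.2 r hr)), self_mem_nhdsWithin] with r hr hr0
    obtain ⟨l, hl1, hrl, h1, h2⟩ := hr
    rw [Set.mem_Ioi] at hr0
    have hM0 := hpos r hr0
    have hT1 : (1 : ENNReal) ≤ returnTime f r y := by exact_mod_cast one_le_returnTime f r y
    set T : ENNReal := (returnTime f r y : ENNReal)
    set M := μ (Metric.ball y r)
    have hq0 : ENNReal.ofReal (Real.exp (-δ)) ^ (5 * l) ≠ 0 :=
      pow_ne_zero _ (by simp [Real.exp_pos])
    have hTt : T ≠ ⊤ := by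
      intro hT
      rw [hT, ENNReal.top_mul hM0.ne', ENNReal.mul_top hq0] at h1
      exact absurd h1 (by simp)
    have hMt : M ≠ ⊤ := measure_ne_top _ _
    have ht : 0 < T.toReal := ENNReal.toReal_pos (zero_lt_one.trans_le hT1).ne' hTt
    have hm : 0 < M.toReal := ENNReal.toReal_pos hM0.ne' hMt
    rw [ENNReal.log_pos_real' ht, ENNReal.log_pos_real' hm]
    rw [← ENNReal.ofReal_toReal hTt, ← ENNReal.ofReal_toReal hMt,
      ← ENNReal.ofReal_mul ht.le, ← ENNReal.ofReal_pow (Real.exp_pos _).le] at h1 h2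
    rw [← ENNReal.ofReal_mul (by positivity), ENNReal.ofReal_le_one] at h1
    rw [ENNReal.ofReal_le_ofReal_iff (by positivity)] at h2
    set t := T.toReal
    set m := M.toReal
    have e1 : Real.log t + Real.log m ≤ 5 * l * δ := by
      have := Real.log_nonpos (by positivity) h1
      rw [Real.log_mul (by positivity) (by positivity), Real.log_mul ht.ne' hm.ne',
        Real.log_pow, Real.log_exp] at this
      push_cast at this
      linarith
    have e2 : -(5 * l * δ) ≤ Real.log t + Real.log m := by
      have := Real.log_le_log (by positivity) h2
      rw [Real.log_mul ht.ne' hm.ne', Real.log_pow, Real.log_exp] at this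
      push_cast at this
      linarith
    have hl0 : (1 : ℝ) ≤ l := by exact_mod_cast hl1
    have hL : (l : ℝ) / 2 ≤ -Real.log r := by
      have := Real.log_le_log hr0 hrl
      rw [Real.log_pow, one_div, Real.log_inv] at this
      nlinarith [Real.log_two_gt_d9]
    have hLog : Real.log (1 / r) = -Real.log r := by rw [one_div, Real.log_inv]
    rw [hLog]
    set L := -Real.log r with hLdef
    have hL0 : 0 < L := by linarith
    refine ⟨Real.log t / L, Real.log m / Real.log r, (EReal.coe_div _ _).symm,
      (EReal.coe_div _ _).symm, ?_⟩
    have hlr : Real.log r = -L := by rw [hLdef, neg_neg]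
    rw [hlr, div_neg (Real.log m), sub_neg_eq_add, ← add_div, abs_div, abs_of_pos hL0, div_le_iff₀ hL0]
    refine (abs_le.2 ⟨e2, e1⟩).trans ?_
    nlinarith
  have h1 : ∀ ε : ℝ, 0 < ε → ∀ᶠ r : ℝ in 𝓝[>] (0 : ℝ),
      ENNReal.log (returnTime f r y : ENNReal) / (Real.log (1 / r) : EReal) ≤
        ENNReal.log (μ (Metric.ball y r)) / (Real.log r : EReal) + ε := fun ε hε => by
    filter_upwards [key ε hε] with r ⟨u, v, hu, hv, huv⟩
    rw [hu, hv, ← EReal.coe_add, EReal.coe_le_coe_iff]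
    linarith [(abs_le.1 huv).2]
  have h2 : ∀ ε : ℝ, 0 < ε → ∀ᶠ r : ℝ in 𝓝[>] (0 : ℝ),
      ENNReal.log (μ (Metric.ball y r)) / (Real.log r : EReal) ≤
        ENNReal.log (returnTime f r y : ENNReal) / (Real.log (1 / r) : EReal) + ε :=
    fun ε hε => by
    filter_upwards [key ε hε] with r ⟨u, v, hu, hv, huv⟩
    rw [hu, hv, ← EReal.coe_add, EReal.coe_le_coe_iff]
    linarith [(abs_le.1 huv).1]
  exact ⟨(liminf_le_liminf_of_eventually_le_add h1).antisymm
      (liminf_le_liminf_of_eventually_le_add h2),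
    (limsup_le_limsup_of_eventually_le_add h1).antisymm
      (limsup_le_limsup_of_eventually_le_add h2)⟩

end Rates

/-! ### Almost sure bounds at all small radii. -/

section

variable {X : Type*} [NormedAddCommGroup X] [InnerProductSpace ℝ X] [FiniteDimensional ℝ X]
  [MeasurableSpace X] [BorelSpace X] {f : X → X} {μ : Measure X} [IsProbabilityMeasure μ]

/-- Kac's bound and weak doubling are used at scale l + d + 1, where cubes have diameter below 2 ^
(-(l + 1)) < r. Their combined cost 2 (l + d + 1) is at most 5 l once l ≥ d + 1. -/
theorem ae_eventually_pow_mul_returnTime_mul_measure_ball_le (hf : MeasurePreserving f μ μ)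
    {q : ENNReal} (hq0 : q ≠ 0) (hq : q < 1) :
    ∀ᵐ y ∂μ, ∀ᶠ l in atTop, ∀ r ∈ Set.Ioc ((1 / 2 : ℝ) ^ (l + 1)) ((1 / 2) ^ l),
      q ^ (5 * l) * ((returnTime f r y : ENNReal) * μ (Metric.ball y r)) ≤ 1 := by
  set d := Module.finrank ℝ X with hd
  filter_upwards [ae_eventually_pow_mul_measure_cube_mul_returnTime_le hf hq0 hq,
    ae_eventually_pow_mul_measure_ball_le μ (2 ^ (d + 1)) hq] with y hkac hreg
  filter_upwards [(tendsto_add_atTop_nat (d + 1)).eventually hkac,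
    (tendsto_add_atTop_nat (d + 1)).eventually hreg, eventually_ge_atTop (d + 1)]
    with l h1 h2 hl r hr
  have e0 : (2 : ℝ) ^ d * (1 / 2) ^ d = 1 := by rw [← mul_pow]; norm_num
  have e1 : (2 : ℝ) ^ d * (1 / 2) ^ (l + (d + 1)) = (1 / 2) ^ (l + 1) := by
    calc _ = (2 : ℝ) ^ d * (1 / 2) ^ d * (1 / 2) ^ (l + 1) := by ring
      _ = _ := by rw [e0, one_mul]
  have e2 : ((2 ^ (d + 1) : ℕ) : ℝ) * (1 / 2) ^ (l + (d + 1)) = (1 / 2) ^ l := by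
    push_cast
    calc _ = (2 : ℝ) ^ d * (1 / 2) ^ d * (1 / 2) ^ l := by ring
      _ = _ := by rw [e0, one_mul]
  rw [← hd, e1] at h1
  rw [e2] at h2
  have hτ : (returnTime f r y : ENNReal) ≤ returnTime f ((1 / 2) ^ (l + 1)) y := by
    exact_mod_cast returnTime_anti f y hr.1.le
  calc q ^ (5 * l) * ((returnTime f r y : ENNReal) * μ (Metric.ball y r))
      ≤ q ^ (2 * (l + (d + 1))) * ((returnTime f ((1 / 2) ^ (l + 1)) y : ENNReal) *
          μ (Metric.ball y ((1 / 2) ^ l))) := by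
        refine mul_le_mul' (pow_le_pow_right_of_le_one' hq.le (by omega))
          (mul_le_mul' hτ (measure_mono (Metric.ball_subset_ball hr.2)))
    _ = q ^ (l + (d + 1)) * (q ^ (l + (d + 1)) * μ (Metric.ball y ((1 / 2) ^ l))) *
          (returnTime f ((1 / 2) ^ (l + 1)) y : ENNReal) := by ring
    _ ≤ q ^ (l + (d + 1)) * μ (cube (l + (d + 1)) (cubeIdx (l + (d + 1)) y)) *
          (returnTime f ((1 / 2) ^ (l + 1)) y : ENNReal) := by gcongr
    _ ≤ 1 := h1

theorem ae_eventually_pow_le_returnTime_dyadic (hf : Measurable f)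
    (hdecay : HasLocalSuperPolynomialDecay f μ) {q : ENNReal} (hq0 : q ≠ 0) (hq : q < 1) :
    ∀ᵐ y ∂μ, 0 < lowerRecurrenceRate f y → ∀ᶠ n in atTop,
      q ^ (3 * n) ≤ (returnTime f ((1 / 2 : ℝ) ^ n) y : ENNReal) *
        μ (Metric.ball y (2 ^ (Module.finrank ℝ X + 2) * (1 / 2 : ℝ) ^ n)) := by
  obtain ⟨𝒱, ⟨hopen, -, hcov⟩, hdec⟩ := hdecay
  -- By the Lindelöf property countably many members cover the same set, so the exceptional null
  -- sets can be united.
  obtain ⟨T, hTc, hT, hTU⟩ := TopologicalSpace.isOpen_sUnion_countable 𝒱 hopen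
  have h1 : ∀ᵐ y ∂μ, ∀ V ∈ T, ∀ A : ℕ, y ∈ V → ∀ᶠ n in atTop, y ∉ earlyReturns f μ A q n := by
    refine (ae_ball_iff hTc).2 fun V hV => ae_all_iff.2 fun A => ?_
    obtain ⟨θ, hθ, h⟩ := hdec V (hT hV)
    exact ae_eventually_notMem_earlyReturns hf (hopen V (hT hV)) hθ h A hq0 hq
  have h2 : ∀ᵐ y ∂μ, y ∈ ⋃₀ T := by rw [hTU]; exact hcov
  filter_upwards [h1, h2, ae_forall_measure_ball_pos μ] with y h1 h2 hpos hR
  obtain ⟨V, hV, hyV⟩ := h2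
  obtain ⟨A, hA⟩ := exists_pow_le_pow_of_lowerRecurrenceRate_pos hR
  filter_upwards [h1 V hV A hyV, hA] with n hn hAn
  rcases returnTime_eq_top_or_exists f ((1 / 2 : ℝ) ^ n) y with h | ⟨k, h, hk, hkd⟩
  -- Positivity of the ball's mass matters here, since ∞ * 0 = 0.
  · rw [h, ENat.toENNReal_top, ENNReal.top_mul (hpos _ (by positivity)).ne']
    exact le_top
  · rw [h, ENat.toENNReal_coe]
    by_contra! hlt
    exact hn ⟨k, hk, hAn k hk hkd, hlt.le, hkd⟩

theorem ae_eventually_pow_le_returnTime_mul_measure_ball (hf : Measurable f)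
    (hdecay : HasLocalSuperPolynomialDecay f μ) {q : ENNReal} (hq0 : q ≠ 0) (hq : q < 1) :
    ∀ᵐ y ∂μ, 0 < lowerRecurrenceRate f y →
      ∀ᶠ l in atTop, ∀ r ∈ Set.Ioc ((1 / 2 : ℝ) ^ (l + 1)) ((1 / 2) ^ l),
        q ^ (5 * l) ≤ (returnTime f r y : ENNReal) * μ (Metric.ball y r) := by
  set d := Module.finrank ℝ X with hd
  filter_upwards [ae_eventually_pow_le_returnTime_dyadic hf hdecay hq0 hq,
    -- At scale l + d + 1 this multiple is the radius 2 ^ (d + 2) * 2⁻ˡ of the early-return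
    -- estimate, while the cube still fits in the ball of radius `r`.
    ae_eventually_pow_mul_measure_ball_le μ (2 ^ (2 * d + 3)) hq] with y hret hreg hR
  filter_upwards [hret hR, (tendsto_add_atTop_nat (d + 1)).eventually hreg,
    eventually_ge_atTop (d + 1)] with l h1 h2 hl r hr
  have e0 : (2 : ℝ) ^ d * (1 / 2) ^ d = 1 := by rw [← mul_pow]; norm_num
  have e1 : (2 : ℝ) ^ d * (1 / 2) ^ (l + (d + 1)) = (1 / 2) ^ (l + 1) := by
    calc _ = (2 : ℝ) ^ d * (1 / 2) ^ d * (1 / 2) ^ (l + 1) := by ring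
      _ = _ := by rw [e0, one_mul]
  have e2 : ((2 ^ (2 * d + 3) : ℕ) : ℝ) * (1 / 2) ^ (l + (d + 1)) =
      2 ^ (d + 2) * (1 / 2) ^ l := by
    push_cast
    calc _ = (2 : ℝ) ^ d * (1 / 2) ^ d * (2 ^ (d + 2) * (1 / 2) ^ l) := by ring
      _ = _ := by rw [e0, one_mul]
  rw [e2] at h2
  have hτ : (returnTime f ((1 / 2) ^ l) y : ENNReal) ≤ returnTime f r y := by
    exact_mod_cast returnTime_anti f y hr.2
  have h3 : q ^ (l + (d + 1)) * μ (Metric.ball y (2 ^ (d + 2) * (1 / 2) ^ l)) ≤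
      μ (Metric.ball y r) := by
    refine h2.trans (measure_mono ((cube_subset_ball _ y).trans (Metric.ball_subset_ball ?_)))
    rw [← hd, e1]
    exact hr.1.le
  calc q ^ (5 * l) ≤ q ^ (l + (d + 1)) * q ^ (3 * l) := by
        rw [← pow_add]
        exact pow_le_pow_right_of_le_one' hq.le (by omega)
    _ ≤ q ^ (l + (d + 1)) * ((returnTime f ((1 / 2) ^ l) y : ENNReal) *
          μ (Metric.ball y (2 ^ (d + 2) * (1 / 2) ^ l))) := by gcongr
    _ = (returnTime f ((1 / 2) ^ l) y : ENNReal) *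
          (q ^ (l + (d + 1)) * μ (Metric.ball y (2 ^ (d + 2) * (1 / 2) ^ l))) := by ring
    _ ≤ _ := by gcongr

end

end Recurrence

theorem theorem2 {X : Type*} [NormedAddCommGroup X] [InnerProductSpace ℝ X]
    [FiniteDimensional ℝ X] [MeasurableSpace X] [BorelSpace X]
    (f : X → X) (μ : Measure X) [IsProbabilityMeasure μ] (hf : MeasurePreserving f μ μ)
    (hdecay : Recurrence.HasLocalSuperPolynomialDecay f μ) :
    ∀ᵐ x ∂μ, 0 < Recurrence.lowerRecurrenceRate f x →
      Recurrence.lowerRecurrenceRate f x = Recurrence.lowerPointwiseDim μ x ∧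
      Recurrence.upperRecurrenceRate f x = Recurrence.upperPointwiseDim μ x := by
  -- Countably many ratios increasing to 1 suffice, which keeps the exceptional set null.
  have hq0 : ∀ j : ℕ, ENNReal.ofReal (Real.exp (-(1 / (j + 1)))) ≠ 0 := fun j => by
    simp [Real.exp_pos]
  have hq1 : ∀ j : ℕ, ENNReal.ofReal (Real.exp (-(1 / (j + 1)))) < 1 := fun j => by
    rw [ENNReal.ofReal_lt_one, Real.exp_lt_one_iff, neg_lt_zero]
    positivity
  filter_upwards [Recurrence.ae_forall_measure_ball_pos μ,
    ae_all_iff.2 fun j =>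
      Recurrence.ae_eventually_pow_mul_returnTime_mul_measure_ball_le hf (hq0 j) (hq1 j),
    ae_all_iff.2 fun j => Recurrence.ae_eventually_pow_le_returnTime_mul_measure_ball
      hf.measurable hdecay (hq0 j) (hq1 j)] with x hpos hub hlb hR
  exact Recurrence.rates_eq_dims_of_eventually hpos hub fun j => hlb j hR
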